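/- Let $m,n\ge 1$, let $A,X\in\mathbb{M}_{m\times n}(\mathbb{C})$ with $A\neq 0$, let $2\le p<\infty$ be real and let $k$ be an integer with $1\le k\le \min\{m,n\}$. Let $\sigma_1(A)\ge\sigma_2(A)\ge\cdots\ge\sigma_{\min\{m,n\}}(A)\geq 0$ be the singular values of $A$ and let $\|A\|_{(p,k)}=\left(\sigma_1^p(A)+\cdots+\sigma_k^p(A)\right)^{1/p}$ be the Ky Fan $p$-$k$ norm. Then the right-hand directional derivative $$D^+\|A\|_{(p,k)}(X)=\lim_{t\to 0^+}\frac{\|A+tX\|_{(p,k)}-\|A\|_{(p,k)}}{t}$$ exists and $$D^+\|A\|_{(p,k)}(X)=\max\left\{\frac{1}{\|A\|_{(p,k)}^{p-1}}\sum_{i=1}^{k}\sigma_i^{p-2}(A)\,\operatorname{Re}\langle Av_i,Xv_i\rangle \;:\; v_1,\ldots,v_k\in\mathbb{C}^n \text{ orthonormal},\ A^*Av_i=\sigma_i^2(A)v_i\ \text{for } 1\le i\le k\right\},$$ the maximum being attained (with $0^0=1$ when $p=2$ and $\sigma_i(A)=0$; the corresponding term vanishes in any case because then $Av_i=0$). 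-/

import Mathlib

open Filter Topology
open scoped Matrix

/-- The singular values of a complex `m × n` matrix in non-increasing order, indexed from `0`:
`singularValue A i` is `σ_{i+1}(A)`.  It is the square root of the `(i+1)`-st largest eigenvalue
of `Aᴴ * A`, counted with multiplicity (and `0` for `i ≥ n`). -/
noncomputable def singularValue {m n : ℕ} (A : Matrix (Fin m) (Fin n) ℂ) (i : ℕ) : ℝ :=
  (Matrix.toEuclideanLin A).singularValues i

/-- The Ky Fan `p`-`k` norm `(σ_1(A)^p + ⋯ + σ_k(A)^p)^(1/p)`. -/
noncomputable def kyFanNorm {m n : ℕ} (p : ℝ) (k : ℕ) (A : Matrix (Fin m) (Fin n) ℂ) : ℝ :=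
  (∑ i : Fin k, singularValue A i ^ p) ^ (1 / p)

/-- `d` is the right hand directional derivative of the Ky Fan `p`-`k` norm at `A` in the
direction `X`: the limit defining it exists and equals `d`. -/
def HasRightDirDerivKyFan {m n : ℕ} (p : ℝ) (k : ℕ) (A X : Matrix (Fin m) (Fin n) ℂ)
    (d : ℝ) : Prop :=
  Tendsto (fun t : ℝ => (kyFanNorm p k (A + (t : ℂ) • X) - kyFanNorm p k A) / t)
    (𝓝[>] (0 : ℝ)) (𝓝 d)

/-- `v_1, …, v_k` are orthonormal vectors of `ℂⁿ` with `Aᴴ A v_i = σ_i(A)² v_i` for all `i`. -/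
def IsTopRightSingularFamily {m n k : ℕ} (A : Matrix (Fin m) (Fin n) ℂ)
    (v : Fin k → EuclideanSpace ℂ (Fin n)) : Prop :=
  Orthonormal ℂ v ∧
    ∀ i : Fin k, Matrix.toEuclideanLin (Aᴴ * A) (v i) = ((singularValue A i ^ 2 : ℝ) : ℂ) • v i

/-! For `2 ≤ p`, the sum of the `k` largest `σ_i(T) ^ p` is the maximum of `∑ ‖T v_i‖ ^ p` over
orthonormal `v`, attained at top singular families (`sum_norm_apply_rpow_le`). Convexity of `‖·‖ ^
p` then gives a tangent bound at any top family (`sum_rpow_add_slope_le`). Used at `T` with step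
`t`, it bounds the difference quotient below by every slope at `T`; used at `T + tS` with step `-t`,
it bounds it above by a slope at `T + tS`. Top families form a closed set in `(t, v)` over a compact
set of `v`, so as `t → 0⁺` the upper bound falls to the maximal slope at `T`. The chain rule for `x
^ (1 / p)` finishes. -/

/-- The sum of `k` weighted values of an antitone sequence, with weights in `[0, 1]` of total
mass `k`, is at most the sum of its first `k` values. -/
theorem sum_mul_le_sum_of_antitone {n k : ℕ} (hk : k ≤ n) {a : ℕ → ℝ} (ha : Antitone a)
    (d : Fin n → ℝ) (hd0 : ∀ j, 0 ≤ d j) (hd1 : ∀ j, d j ≤ 1) (hd : ∑ j, d j = k) :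
    ∑ j, d j * a j ≤ ∑ i : Fin k, a i := by
  -- The weights and the indicator of `j < k` have equal mass, so subtracting the pivot `a (k - 1)`
  -- changes nothing in the sum and gives every term a sign.
  have key : ∀ j : Fin n, (d j - if (j : ℕ) < k then 1 else 0) * (a j - a (k - 1)) ≤ 0 := by
    intro j
    split_ifs with h
    · exact mul_nonpos_of_nonpos_of_nonneg (by linarith [hd1 j])
        (sub_nonneg.2 (ha (by omega)))
    · exact mul_nonpos_of_nonneg_of_nonpos (by linarith [hd0 j])
        (sub_nonpos.2 (ha (by omega)))
  have hind : ∀ f : ℕ → ℝ, ∑ j : Fin n, (if (j : ℕ) < k then 1 else 0) * f j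
      = ∑ i : Fin k, f i := by
    intro f
    rw [Fin.sum_univ_eq_sum_range (fun j => (if j < k then 1 else 0) * f j) n,
      Fin.sum_univ_eq_sum_range f k, ← Finset.sum_subset (Finset.range_subset_range.2 hk)]
    · exact Finset.sum_congr rfl fun x hx => by simp [Finset.mem_range.1 hx]
    · intro x _ hx
      simp_all
  have h := Finset.sum_nonpos fun j (_ : j ∈ Finset.univ) => key j
  have h1 := hind fun _ => 1
  simp only [mul_one, Finset.sum_const, Finset.card_univ, Fintype.card_fin, nsmul_eq_mul] at h1
  simp only [sub_mul, mul_sub, Finset.sum_sub_distrib, hind, ← Finset.sum_mul, hd, h1] at h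
  linarith

/-- The tangent inequality for `x ^ p` on the nonnegative reals. -/
theorem rpow_add_mul_sub_le_rpow {p a b : ℝ} (hp : 1 < p) (ha : 0 ≤ a) (hb : 0 ≤ b) :
    a ^ p + p * a ^ (p - 1) * (b - a) ≤ b ^ p := by
  rcases ha.eq_or_lt with rfl | ha
  · rw [Real.zero_rpow (by linarith), Real.zero_rpow (by linarith)]
    simpa using Real.rpow_nonneg hb p
  · have h := one_add_mul_self_le_rpow_one_add (s := b / a - 1)
      (by linarith [div_nonneg hb ha.le]) hp.le
    rw [add_sub_cancel, Real.div_rpow hb ha.le, le_div_iff₀ (by positivity)] at h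
    refine le_of_eq_of_le ?_ h
    rw [Real.rpow_sub_one ha.ne']
    field_simp

/-- The tangent inequality for the `p`-th power of the norm of an inner product space. -/
theorem norm_rpow_add_mul_re_inner_le {F : Type*} [NormedAddCommGroup F] [InnerProductSpace ℂ F]
    {p : ℝ} (hp : 2 ≤ p) (x h : F) :
    ‖x‖ ^ p + p * (‖x‖ ^ (p - 2) * (inner ℂ x h).re) ≤ ‖x + h‖ ^ p := by
  -- Cauchy–Schwarz for `x` and `x + h` reduces the claim to the scalar tangent inequality at `‖x‖`.
  have h1 : (inner ℂ x h).re ≤ ‖x‖ * (‖x + h‖ - ‖x‖) := by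
    have h2 : (inner ℂ x (x + h)).re ≤ ‖x‖ * ‖x + h‖ := re_inner_le_norm (𝕜 := ℂ) x (x + h)
    have h3 : (inner ℂ x x).re = ‖x‖ ^ 2 := inner_self_eq_norm_sq (𝕜 := ℂ) x
    rw [inner_add_right, Complex.add_re, h3] at h2
    linarith
  refine le_trans ?_ (rpow_add_mul_sub_le_rpow (by linarith) (norm_nonneg x) (norm_nonneg (x + h)))
  have h4 : ‖x‖ ^ (p - 2) * ‖x‖ = ‖x‖ ^ (p - 1) := by
    rw [← Real.rpow_add_one' (norm_nonneg x) (by linarith)]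
    ring_nf
  have h5 : ‖x‖ ^ (p - 2) * (inner ℂ x h).re ≤ ‖x‖ ^ (p - 1) * (‖x + h‖ - ‖x‖) := by
    rw [← h4, mul_assoc]
    exact mul_le_mul_of_nonneg_left h1 (by positivity)
  nlinarith [h5]

/-! ### Singular families and the variational principle -/

namespace LinearMap

open Module

variable {E F : Type*} [NormedAddCommGroup E] [InnerProductSpace ℂ E] [FiniteDimensional ℂ E]
  [NormedAddCommGroup F] [InnerProductSpace ℂ F]

theorem continuous_add_smul_apply (T S : E →ₗ[ℂ] F) :
    Continuous fun q : ℝ × E => (T + (q.1 : ℂ) • S) q.2 := by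
  have hT := T.continuous_of_finiteDimensional
  have hS := S.continuous_of_finiteDimensional
  simp only [add_apply, smul_apply]
  fun_prop

/-- The derivative of `∑ ‖T v_i‖ ^ p / p` in the direction `S`. -/
noncomputable def powerSumSlope (p : ℝ) {k : ℕ} (T S : E →ₗ[ℂ] F) (v : Fin k → E) : ℝ :=
  ∑ i, ‖T (v i)‖ ^ (p - 2) * (inner ℂ (T (v i)) (S (v i))).re

theorem continuous_powerSumSlope {p : ℝ} (hp : 2 ≤ p) (k : ℕ) (T S : E →ₗ[ℂ] F) :
    Continuous fun q : ℝ × (Fin k → E) => powerSumSlope p (T + (q.1 : ℂ) • S) S q.2 := by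
  refine continuous_finsetSum _ fun i _ => ?_
  have h : Continuous fun q : ℝ × (Fin k → E) => (T + (q.1 : ℂ) • S) (q.2 i) :=
    (continuous_add_smul_apply T S).comp
      (continuous_fst.prodMk ((continuous_apply i).comp continuous_snd))
  have hS := S.continuous_of_finiteDimensional
  exact (h.norm.rpow_const fun _ => Or.inr (by linarith)).mul
    (Complex.continuous_re.comp (h.inner (hS.comp ((continuous_apply i).comp continuous_snd))))

variable [FiniteDimensional ℂ F]

/-- An orthonormal family of right singular vectors for the largest singular values. -/
def IsTopSingularFamily {k : ℕ} (T : E →ₗ[ℂ] F) (v : Fin k → E) : Prop :=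
  Orthonormal ℂ v ∧ ∀ i : Fin k, adjoint T (T (v i)) = ((T.singularValues i ^ 2 : ℝ) : ℂ) • v i

theorem adjoint_apply_eigenvectorBasis (T : E →ₗ[ℂ] F) {n : ℕ} (hn : finrank ℂ E = n)
    (j : Fin n) :
    adjoint T (T (T.isSymmetric_adjoint_comp_self.eigenvectorBasis hn j)) =
      ((T.singularValues j ^ 2 : ℝ) : ℂ) • T.isSymmetric_adjoint_comp_self.eigenvectorBasis hn j := by
  have h := T.isSymmetric_adjoint_comp_self.apply_eigenvectorBasis hn j
  rw [← T.sq_singularValues_fin hn] at h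
  exact h

theorem exists_isTopSingularFamily (T : E →ₗ[ℂ] F) {k : ℕ} (hk : k ≤ finrank ℂ E) :
    ∃ v : Fin k → E, T.IsTopSingularFamily v :=
  ⟨fun i => T.isSymmetric_adjoint_comp_self.eigenvectorBasis rfl (Fin.castLE hk i),
    (OrthonormalBasis.orthonormal _).comp _ (Fin.castLE_injective hk),
    fun i => T.adjoint_apply_eigenvectorBasis rfl (Fin.castLE hk i)⟩

theorem IsTopSingularFamily.norm_apply {k : ℕ} {T : E →ₗ[ℂ] F} {v : Fin k → E}
    (hv : T.IsTopSingularFamily v) (i : Fin k) : ‖T (v i)‖ = T.singularValues i := by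
  have h : inner ℂ (v i) (adjoint T (T (v i))) = ((T.singularValues i ^ 2 : ℝ) : ℂ) := by
    rw [hv.2 i, inner_smul_right, inner_self_eq_norm_sq_to_K, hv.1.1 i]
    simp
  rw [adjoint_inner_right, inner_self_eq_norm_sq_to_K] at h
  exact (sq_eq_sq₀ (norm_nonneg _) (T.singularValues_nonneg i)).1 
    (Complex.ofReal_injective (by simpa using h))

theorem norm_apply_sq_eq_sum (T : E →ₗ[ℂ] F) {n : ℕ} (hn : finrank ℂ E = n) (x : E) :
    ‖T x‖ ^ 2 = ∑ j : Fin n,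
      ‖inner ℂ (T.isSymmetric_adjoint_comp_self.eigenvectorBasis hn j) x‖ ^ 2 *
        T.singularValues j ^ 2 := by
  set b := T.isSymmetric_adjoint_comp_self.eigenvectorBasis hn with hb
  have h : inner ℂ x (adjoint T (T x)) = ((‖T x‖ ^ 2 : ℝ) : ℂ) := by
    rw [adjoint_inner_right, inner_self_eq_norm_sq_to_K]
    simp
  have h1 : ∀ j, inner ℂ (b j) (adjoint T (T x)) =
      ((T.singularValues j ^ 2 : ℝ) : ℂ) * inner ℂ (b j) x := by
    intro j
    rw [adjoint_inner_right, ← adjoint_inner_left, T.adjoint_apply_eigenvectorBasis hn,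
      inner_smul_left, Complex.conj_ofReal]
  rw [← b.sum_inner_mul_inner] at h
  apply Complex.ofReal_injective
  rw [← h, Complex.ofReal_sum]
  refine Finset.sum_congr rfl fun j _ => ?_
  rw [h1, ← inner_conj_symm x (b j), mul_left_comm, mul_comm, Complex.conj_mul']
  push_cast
  rfl

/-- Among orthonormal families, the right singular vectors of the largest singular values maximize
the sum of the `p`-th powers of the norms of the images. -/
theorem sum_norm_apply_rpow_le (T : E →ₗ[ℂ] F) {p : ℝ} (hp : 2 ≤ p) {k : ℕ} {v : Fin k → E}
    (hv : Orthonormal ℂ v) :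
    ∑ i, ‖T (v i)‖ ^ p ≤ ∑ i : Fin k, T.singularValues i ^ p := by
  set b := T.isSymmetric_adjoint_comp_self.eigenvectorBasis rfl with hb
  have hpow : ∀ x : ℝ, 0 ≤ x → (x ^ 2) ^ (p / 2) = x ^ p := by
    intro x hx
    rw [← Real.rpow_natCast, ← Real.rpow_mul hx]
    congr 1
    push_cast
    ring
  have hsum : ∀ x, ∑ j, ‖inner ℂ (b j) x‖ ^ 2 = ‖x‖ ^ 2 := b.sum_sq_norm_inner_right
  have h1 : ∀ i, ‖T (v i)‖ ^ p ≤ ∑ j, ‖inner ℂ (b j) (v i)‖ ^ 2 * T.singularValues j ^ p := by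
    intro i
    -- Jensen for `x ^ (p / 2)`, convex since `2 ≤ p`; the weights sum to `1` by Parseval.
    have h := Real.rpow_arith_mean_le_arith_mean_rpow Finset.univ
      (fun j => ‖inner ℂ (b j) (v i)‖ ^ 2) (fun j => T.singularValues j ^ 2)
      (fun _ _ => by positivity) (by rw [hsum, hv.1 i, one_pow]) (fun _ _ => by positivity)
      (p := p / 2) (by linarith)
    rw [← T.norm_apply_sq_eq_sum rfl, hpow _ (norm_nonneg _)] at h
    simpa only [hpow _ (T.singularValues_nonneg _)] using h
  refine (Finset.sum_le_sum fun i _ => h1 i).trans ?_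
  rw [Finset.sum_comm]
  simp only [← Finset.sum_mul]
  refine sum_mul_le_sum_of_antitone (a := fun j => T.singularValues j ^ p) ?_ ?_ _ ?_ ?_ ?_
  · simpa using hv.linearIndependent.fintype_card_le_finrank
  · exact fun i j hij => Real.rpow_le_rpow (T.singularValues_nonneg _)
      (T.singularValues_antitone hij) (by linarith)
  · exact fun j => Finset.sum_nonneg fun i _ => by positivity
  · intro j
    -- Bessel's inequality bounds each weight by `1`; Parseval gives total mass `k`.
    have h := hv.sum_inner_products_le (b j) (s := Finset.univ)
    rw [b.orthonormal.1 j, one_pow] at h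
    simpa only [norm_inner_symm] using h
  · rw [Finset.sum_comm]
    simp [hsum, hv.1]

theorem IsTopSingularFamily.sum_norm_apply_rpow {k : ℕ} {T : E →ₗ[ℂ] F} {v : Fin k → E}
    (hv : T.IsTopSingularFamily v) (p : ℝ) :
    ∑ i, ‖T (v i)‖ ^ p = ∑ i : Fin k, T.singularValues i ^ p :=
  Finset.sum_congr rfl fun i _ => by rw [hv.norm_apply i]

/-! ### Compactness and continuity -/

variable (E) in
theorem isCompact_setOf_orthonormal (k : ℕ) : IsCompact {v : Fin k → E | Orthonormal ℂ v} := by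
  refine (isCompact_univ_pi fun _ : Fin k => isCompact_sphere (0 : E) 1).of_isClosed_subset ?_
    fun v hv i _ => by simpa using hv.1 i
  simp only [orthonormal_iff_ite, Set.ofPred_forall]
  exact isClosed_iInter fun i => isClosed_iInter fun j =>
    isClosed_eq (by fun_prop) continuous_const

/-- By the variational principle with `p = 2`, this is a supremum of a jointly continuous function
over a fixed compact set. -/
theorem continuous_sum_sq_singularValues (T S : E →ₗ[ℂ] F) {k : ℕ} (hk : k ≤ finrank ℂ E) :
    Continuous fun t : ℝ => ∑ i : Fin k, (T + (t : ℂ) • S).singularValues i ^ 2 := by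
  have hg : Continuous fun q : ℝ × (Fin k → E) =>
      ∑ i, ‖(T + (q.1 : ℂ) • S) (q.2 i)‖ ^ 2 :=
    continuous_finsetSum _ fun i _ => ((continuous_add_smul_apply T S).comp
      (continuous_fst.prodMk ((continuous_apply i).comp continuous_snd))).norm.pow 2
  have hc := (isCompact_setOf_orthonormal E k).continuous_sSup
    (f := fun (t : ℝ) (v : Fin k → E) => ∑ i, ‖(T + (t : ℂ) • S) (v i)‖ ^ 2) hg
  convert hc using 2 with t
  obtain ⟨v, hv⟩ := (T + (t : ℂ) • S).exists_isTopSingularFamily hk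
  symm
  apply IsGreatest.csSup_eq
  constructor
  · exact ⟨v, hv.1, Finset.sum_congr rfl fun i _ => by rw [hv.norm_apply i]⟩
  · rintro _ ⟨w, hw, rfl⟩
    simpa only [Real.rpow_two] using (T + (t : ℂ) • S).sum_norm_apply_rpow_le le_rfl hw

theorem continuous_singularValues (T S : E →ₗ[ℂ] F) (j : ℕ) :
    Continuous fun t : ℝ => (T + (t : ℂ) • S).singularValues j := by
  by_cases hj : finrank ℂ E ≤ j
  · simp only [singularValues_of_finrank_le _ hj]
    exact continuous_const
  -- `σ_j ^ 2` is the difference of two consecutive partial sums.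
  · have h := (continuous_sum_sq_singularValues T S (k := j + 1) (by omega)).sub
      (continuous_sum_sq_singularValues T S (k := j) (by omega))
    simp only [Fin.sum_univ_castSucc, Fin.val_castSucc, Fin.val_last] at h
    simpa only [Pi.sub_apply, add_sub_cancel_left, Real.sqrt_sq (singularValues_nonneg _ _)] using h.sqrt

theorem isClosed_setOf_isTopSingularFamily (k : ℕ) (T S : E →ₗ[ℂ] F) :
    IsClosed {q : ℝ × (Fin k → E) | (T + (q.1 : ℂ) • S).IsTopSingularFamily q.2} := by
  have h0 : IsClosed {q : ℝ × (Fin k → E) | Orthonormal ℂ q.2} :=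
    (isCompact_setOf_orthonormal E k).isClosed.preimage continuous_snd
  simp only [IsTopSingularFamily, Set.ofPred_and, Set.ofPred_forall]
  refine h0.inter (isClosed_iInter fun i => isClosed_eq ?_ ?_)
  · have h : Continuous fun q : ℝ × (Fin k → E) => (T + (q.1 : ℂ) • S) (q.2 i) :=
      (continuous_add_smul_apply T S).comp
        (continuous_fst.prodMk ((continuous_apply i).comp continuous_snd))
    simp only [map_add, LinearEquiv.map_smulₛₗ, Complex.conj_ofReal]
    have hT := (adjoint T).continuous_of_finiteDimensional
    have hS := (adjoint S).continuous_of_finiteDimensional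
    exact (hT.comp h).add ((Complex.continuous_ofReal.comp continuous_fst).smul (hS.comp h))
  · exact (Complex.continuous_ofReal.comp
      (((continuous_singularValues T S i).comp continuous_fst).pow 2)).smul
      ((continuous_apply i).comp continuous_snd)

theorem isCompact_setOf_isTopSingularFamily (k : ℕ) (T : E →ₗ[ℂ] F) :
    IsCompact {v : Fin k → E | T.IsTopSingularFamily v} := by
  refine (isCompact_setOf_orthonormal E k).of_isClosed_subset ?_ fun v hv => hv.1
  have h := (isClosed_setOf_isTopSingularFamily k T 0).preimage
    (f := fun v : Fin k → E => ((0 : ℝ), v)) (by fun_prop)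
  simpa using h

/-! ### The one-sided derivative -/

/-- The family `v` is optimal for `T` and merely admissible for `T + tS`. The sign of `t` is free,
so the bound can also be read backwards. -/
theorem sum_rpow_add_slope_le {p : ℝ} (hp : 2 ≤ p) {k : ℕ} {T : E →ₗ[ℂ] F} {v : Fin k → E}
    (hv : T.IsTopSingularFamily v) (S : E →ₗ[ℂ] F) (t : ℝ) :
    ∑ i : Fin k, T.singularValues i ^ p + t * (p * powerSumSlope p T S v) ≤
      ∑ i : Fin k, (T + (t : ℂ) • S).singularValues i ^ p := by
  refine le_trans (le_of_eq_of_le ?_ (Finset.sum_le_sum fun i _ =>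
    norm_rpow_add_mul_re_inner_le hp (T (v i)) ((t : ℂ) • S (v i))))
    ((T + (t : ℂ) • S).sum_norm_apply_rpow_le hp hv.1)
  rw [Finset.sum_add_distrib, hv.sum_norm_apply_rpow, powerSumSlope, Finset.mul_sum,
    Finset.mul_sum]
  congr 1
  refine Finset.sum_congr rfl fun i _ => ?_
  rw [inner_smul_right, Complex.re_ofReal_mul]
  ring

/-- The sum of the `p`-th powers of the `k` largest singular values has a right derivative, given
by the largest slope. -/
theorem exists_tendsto_slope_sum_rpow {p : ℝ} (hp : 2 ≤ p) {k : ℕ} (hk : k ≤ finrank ℂ E)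
    (T S : E →ₗ[ℂ] F) :
    ∃ d : ℝ, IsGreatest (powerSumSlope p T S '' {v : Fin k → E | T.IsTopSingularFamily v}) d ∧
      Tendsto (fun t : ℝ => (∑ i : Fin k, (T + (t : ℂ) • S).singularValues i ^ p -
        ∑ i : Fin k, T.singularValues i ^ p) / t) (𝓝[>] 0) (𝓝 (p * d)) := by
  have hc0 : Continuous (powerSumSlope (k := k) p T S) := by
    have h := (continuous_powerSumSlope hp k T S).comp
      (g := fun q : ℝ × (Fin k → E) => powerSumSlope p (T + (q.1 : ℂ) • S) S q.2)
      (f := fun v : Fin k → E => ((0 : ℝ), v)) (by fun_prop)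
    simpa [Function.comp_def] using h
  obtain ⟨d, hd⟩ := ((isCompact_setOf_isTopSingularFamily k T).image hc0).exists_isGreatest
    (Set.Nonempty.image _ (T.exists_isTopSingularFamily hk))
  refine ⟨d, hd, ?_⟩
  have hp0 : 0 < p := by linarith
  rw [tendsto_order]
  constructor
  · intro a ha
    obtain ⟨v, hv, rfl⟩ := hd.1
    filter_upwards [self_mem_nhdsWithin] with t ht
    refine ha.trans_le ?_
    rw [le_div_iff₀ ht]
    linarith [sum_rpow_add_slope_le hp hv S t]
  · intro a ha
    have hK := isCompact_setOf_orthonormal E k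
    have : CompactSpace {v : Fin k → E | Orthonormal ℂ v} := isCompact_iff_compactSpace.1 hK
    -- The bad pairs `(t, v)`, with slope at least `a / p`, form a closed set. Its projection along
    -- the compact factor is closed and misses `0`, hence misses all small `t`.
    have hcl : IsClosed {q : ℝ × (Fin k → E) | (T + (q.1 : ℂ) • S).IsTopSingularFamily q.2 ∧
        a ≤ p * powerSumSlope p (T + (q.1 : ℂ) • S) S q.2} :=
      (isClosed_setOf_isTopSingularFamily k T S).inter
        (isClosed_le continuous_const (continuous_const.mul (continuous_powerSumSlope hp k T S)))
    have hpr := isClosedMap_fst_of_compactSpace (X := ℝ)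
      (Y := {v : Fin k → E | Orthonormal ℂ v}) _ (hcl.preimage
        (f := fun q : ℝ × {v : Fin k → E | Orthonormal ℂ v} => (q.1, (q.2 : Fin k → E)))
        (by fun_prop))
    have h0 : (0 : ℝ) ∉ (Prod.fst '' ((fun q : ℝ × {v : Fin k → E | Orthonormal ℂ v} =>
        (q.1, (q.2 : Fin k → E))) ⁻¹' {q : ℝ × (Fin k → E) |
          (T + (q.1 : ℂ) • S).IsTopSingularFamily q.2 ∧
            a ≤ p * powerSumSlope p (T + (q.1 : ℂ) • S) S q.2})) := by
      rintro ⟨⟨t, v⟩, ⟨hv, hav⟩, rfl⟩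
      simp only [Complex.ofReal_zero, zero_smul, add_zero] at hv hav
      have := mul_le_mul_of_nonneg_left (hd.2 ⟨v, hv, rfl⟩) hp0.le
      linarith
    filter_upwards [self_mem_nhdsWithin,
      nhdsWithin_le_nhds (hpr.isOpen_compl.mem_nhds h0)] with t ht hmem
    obtain ⟨v, hv⟩ := (T + (t : ℂ) • S).exists_isTopSingularFamily hk
    have hlt : p * powerSumSlope p (T + (t : ℂ) • S) S v < a := by
      by_contra! hle
      exact hmem ⟨(t, ⟨v, hv.1⟩), ⟨hv, hle⟩, rfl⟩
    refine lt_of_le_of_lt ?_ hlt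
    rw [div_le_iff₀ ht]
    -- Tangent bound based at `T + tS`, stepping back to `T`.
    have h := sum_rpow_add_slope_le hp hv S (-t)
    have hback : T + (t : ℂ) • S + ((-t : ℝ) : ℂ) • S = T := by
      push_cast
      module
    rw [hback] at h
    linarith

end LinearMap

/-! ### Matrices and the `p`-th root -/

theorem mainTheorem10 {m n : ℕ} (A X : Matrix (Fin m) (Fin n) ℂ) (hA : A ≠ 0)
    (p : ℝ) (hp : 2 ≤ p) (k : ℕ) (hk1 : 1 ≤ k) (hk : k ≤ min m n) :
    ∃ d : ℝ, HasRightDirDerivKyFan p k A X d ∧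
      IsGreatest
        {r : ℝ | ∃ v : Fin k → EuclideanSpace ℂ (Fin n), IsTopRightSingularFamily A v ∧
          r = 1 / kyFanNorm p k A ^ (p - 1) *
            ∑ i : Fin k, singularValue A i ^ (p - 2) *
              (inner ℂ (Matrix.toEuclideanLin A (v i)) (Matrix.toEuclideanLin X (v i))).re} d := by
  have htop : ∀ v : Fin k → EuclideanSpace ℂ (Fin n),
      IsTopRightSingularFamily A v ↔ (Matrix.toEuclideanLin A).IsTopSingularFamily v := by
    intro v
    have h : ∀ x, Matrix.toEuclideanLin (Aᴴ * A) x =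
        LinearMap.adjoint (Matrix.toEuclideanLin A) (Matrix.toEuclideanLin A x) := by
      intro x
      rw [← Matrix.toEuclideanLin_conjTranspose_eq_adjoint]
      exact LinearMap.congr_fun (Matrix.toLpLin_mul _ _ _ _ _) x
    simp only [IsTopRightSingularFamily, LinearMap.IsTopSingularFamily, h, singularValue]
  have hp0 : 0 < p := by linarith
  obtain ⟨d, hd, hlim⟩ := LinearMap.exists_tendsto_slope_sum_rpow hp (k := k)
    (by simpa using hk.trans (min_le_right m n)) (Matrix.toEuclideanLin A)
    (Matrix.toEuclideanLin X)
  set T := Matrix.toEuclideanLin A with hT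
  set S := Matrix.toEuclideanLin X with hS
  set c := ∑ i : Fin k, T.singularValues i ^ p with hc
  -- `A ≠ 0` and `1 ≤ k` keep `c` away from `0`, where `x ^ (1 / p)` is not differentiable.
  have hcpos : 0 < c := by
    have h0 : 0 < T.singularValues 0 := by
      rw [LinearMap.singularValues_pos_iff_lt_finrank_range, Module.finrank_pos_iff,
        Submodule.nontrivial_iff_ne_bot, Ne, LinearMap.range_eq_bot]
      simpa [hT] using hA
    exact (Real.rpow_pos_of_pos h0 p).trans_le
      (Finset.single_le_sum (f := fun i : Fin k => T.singularValues i ^ p)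
        (fun i _ => Real.rpow_nonneg (T.singularValues_nonneg i) p)
        (Finset.mem_univ ⟨0, hk1⟩))
  have hnorm : kyFanNorm p k A = c ^ (1 / p) := rfl
  have hnorm' : ∀ t : ℝ, kyFanNorm p k (A + (t : ℂ) • X) =
      (∑ i : Fin k, (T + (t : ℂ) • S).singularValues i ^ p) ^ (1 / p) := by
    intro t
    simp only [kyFanNorm, singularValue, hT, hS, map_add, map_smul]
  have hcoef : 1 / kyFanNorm p k A ^ (p - 1) = c ^ (1 / p - 1) := by
    rw [hnorm, ← Real.rpow_mul hcpos.le, one_div, ← Real.rpow_neg hcpos.le]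
    congr 1
    field_simp
    ring
  refine ⟨c ^ (1 / p - 1) * d, ?_, ?_, ?_⟩
  · have hder : HasDerivWithinAt
        (fun t : ℝ => ∑ i : Fin k, (T + (t : ℂ) • S).singularValues i ^ p) (p * d)
        (Set.Ioi 0) 0 := by
      rw [hasDerivWithinAt_iff_tendsto_slope' (by simp)]
      simpa [slope_fun_def_field] using hlim
    have h := hder.rpow_const (p := 1 / p) (Or.inl (by simpa using hcpos.ne'))
    rw [hasDerivWithinAt_iff_tendsto_slope' (by simp)] at h
    unfold HasRightDirDerivKyFan
    simp only [hnorm, hnorm']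
    convert h using 2
    · simp [slope_def_field, hc]
    · simp only [Complex.ofReal_zero, zero_smul, add_zero, ← hc]
      field_simp
  · obtain ⟨v, hv, hvd⟩ := hd.1
    refine ⟨v, (htop v).2 hv, ?_⟩
    rw [hcoef, ← hvd, LinearMap.powerSumSlope]
    simp only [hv.norm_apply, singularValue, ← hT]
  · rintro _ ⟨v, hv, rfl⟩
    rw [htop] at hv
    rw [hcoef]
    refine mul_le_mul_of_nonneg_left ?_ (by positivity)
    have h := hd.2 ⟨v, hv, rfl⟩
    simp only [LinearMap.powerSumSlope, hv.norm_apply] at h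
    exact h
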